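/- Let $G$ be a finite connected simple plane graph in which every vertex has degree $2$ or $3$, together with a (possibly empty) set of its faces, called the external faces (the outer face and possibly further ones), such that every external face is incident to a vertex of degree $2$, every vertex of degree $2$ is incident to an external face, and every face that is not external is a hexagon or has only vertices of degree $3$ on its boundary (such a $G$ is called a hexagonal patch). Suppose that $G$ is pseudoconvex, i.e. no edge on the boundary of an external face has both endpoints of degree $3$. An internal $k$-gonal defect, $k\neq 6$, is a face with a boundary walk of length $k$, all of whose vertices have degree $3$. Let $n$ be the number of vertices of $G$, let $n_2$ be the number of vertices of degree $2$, let $o_k$ ($k$ odd) be the number of internal $k$-gonal defects, and let $e_k$ ($k\ne 6$ even) be the number of internal $k$-gonal defects. Then the saturation number $s(G)$, the number of edges in a smallest maximal matching of $G$, satisfies $$s(G)\ \ge\ \frac n3-\frac1{18}\Bigl(\sum_{k\text{ odd}}(k-2)\,o_k+\sum_{k\text{ even},\,k\neq 6}k\,e_k\Bigr)-\frac{n_2}{6}.$$ -/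

import Mathlib

/-- A rotation system on a graph: a cyclic order on the darts (oriented edges) leaving each
vertex.  It describes a cellular embedding of a connected graph in an oriented closed surface
up to homeomorphism. -/
structure RotationSystem {V : Type*} (G : SimpleGraph V) where
  /-- The next dart around the tail of a dart. -/
  next : Equiv.Perm G.Dart
  next_fst : ∀ d, (next d).fst = d.fst
  next_cyclic : ∀ d e : G.Dart, d.fst = e.fst → next.SameCycle d e

namespace RotationSystem

/-- One step of face tracing: traverse the dart `d`, then leave its head along the dart that
follows the reversal of `d` in the rotation. -/
def facePerm {V : Type*} {G : SimpleGraph V} (R : RotationSystem G) : Equiv.Perm G.Dart :=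
  (Function.Involutive.toPerm SimpleGraph.Dart.symm SimpleGraph.Dart.symm_involutive).trans R.next

/-- The faces of the embedding: the orbits of face tracing. -/
def Face {V : Type*} {G : SimpleGraph V} (R : RotationSystem G) : Type _ :=
  Quotient (Equiv.Perm.SameCycle.setoid R.facePerm)

/-- The face that is traced by a dart. -/
def faceOf {V : Type*} {G : SimpleGraph V} (R : RotationSystem G) (d : G.Dart) : R.Face :=
  Quotient.mk (Equiv.Perm.SameCycle.setoid R.facePerm) d

/-- The length of the boundary walk of a face; `F` is `k`-gonal if `R.faceLength F = k`. -/
noncomputable def faceLength {V : Type*} {G : SimpleGraph V} (R : RotationSystem G)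
    (F : R.Face) : ℕ :=
  {d : G.Dart | R.faceOf d = F}.ncard

/-- A vertex is incident to a face if it lies on its boundary walk. -/
def Incident {V : Type*} {G : SimpleGraph V} (R : RotationSystem G) (v : V) (F : R.Face) : Prop :=
  ∃ d : G.Dart, d.fst = v ∧ R.faceOf d = F

/-- `R` is an embedding of the connected graph `G` (with at least one edge) in the sphere:
Euler's formula `|V| - |E| + |F| = 2` holds. -/
def IsPlanar {V : Type*} [Fintype V] [DecidableEq V] {G : SimpleGraph V} [DecidableRel G.Adj]
    (R : RotationSystem G) : Prop :=
  G.Connected ∧ Fintype.card V + Nat.card R.Face = G.edgeFinset.card + 2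

/-- All vertices incident to the face have degree 3. -/
def IsInternal {V : Type*} [Fintype V] [DecidableEq V] {G : SimpleGraph V} [DecidableRel G.Adj]
    (R : RotationSystem G) (F : R.Face) : Prop :=
  ∀ v, R.Incident v F → G.degree v = 3

/-- A hexagonal patch with defects.  The set `ext` consists of the external faces: the outer
face and all further external defects. A vertex that lies on no external face is an internal
vertex. -/
structure IsPatch {V : Type*} [Fintype V] [DecidableEq V] {G : SimpleGraph V} [DecidableRel G.Adj]
    (R : RotationSystem G) (ext : Set R.Face) : Prop where
  planar : R.IsPlanar
  degree_eq : ∀ v, G.degree v = 2 ∨ G.degree v = 3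
  /-- Internal vertices have degree 3. -/
  degree_internal : ∀ v, (∀ F ∈ ext, ¬ R.Incident v F) → G.degree v = 3
  /-- External faces are incident to vertices of degree 2. -/
  external : ∀ F ∈ ext, ∃ v, R.Incident v F ∧ G.degree v = 2
  /-- A face that is not external is a hexagon or an internal defect. -/
  hexagon_or_internal : ∀ F, F ∉ ext → R.faceLength F = 6 ∨ R.IsInternal F

/-- There is no bend edge: no edge on the boundary of an external face has two endpoints of
degree 3. -/
def IsPseudoconvex {V : Type*} [Fintype V] [DecidableEq V] {G : SimpleGraph V}
    [DecidableRel G.Adj] (R : RotationSystem G) (ext : Set R.Face) : Prop :=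
  ∀ d : G.Dart, R.faceOf d ∈ ext → ¬ (G.degree d.fst = 3 ∧ G.degree d.snd = 3)

/-- The number of `k`-gonal faces all of whose vertices have degree 3. For `k ≠ 6` these are the
internal `k`-gonal defects. -/
noncomputable def numInternal {V : Type*} [Fintype V] [DecidableEq V] {G : SimpleGraph V}
    [DecidableRel G.Adj] (R : RotationSystem G) (k : ℕ) : ℕ :=
  {F : R.Face | R.faceLength F = k ∧ R.IsInternal F}.ncard

end RotationSystem

/-- The saturation number: the number of edges of a smallest maximal matching. -/
noncomputable def saturationNumber {V : Type*} (G : SimpleGraph V) : ℕ :=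
  sInf {m | ∃ M : G.Subgraph,
    Maximal (fun M' : G.Subgraph => M'.IsMatching) M ∧ M.edgeSet.ncard = m}

/-- The number of vertices of degree 2. -/
def numDegreeTwo {V : Type*} [Fintype V] [DecidableEq V] (G : SimpleGraph V)
    [DecidableRel G.Adj] : ℕ :=
  (Finset.univ.filter fun v => G.degree v = 2).card

/-!
Fix a maximal matching `M`, and call a corner of a face unsaturated if its vertex is not covered
by `M`. The other corners are either outward (the matching edge of the vertex is not on the
boundary walk at this corner) or an end of a matching edge of the boundary walk. By maximality no
two consecutive corners are unsaturated. An unsaturated corner is supported if both of its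
neighbours on the boundary walk are matched along that walk.

For each single face, let `T` be the number of unsaturated corners that are not supported minus the
number of outward corners. In a boundary walk of length `k` with `a` unsupported and `s` supported
unsaturated corners, `w` outward corners and `m` matching edges one has `k = a + s + w + 2m`,
`a ≤ 2w`, `a + s ≤ m + w` and `s ≤ m`. For a hexagon this forces `T ≤ 0`
(`cnt_unsat_le_of_card_eq_six`), for other faces `3T ≤ k - 2` (`three_mul_cnt_unsat_le`). On an
external face of a pseudoconvex patch, the number of unsaturated corners, supported or not, is at
most the number of outward corners plus that of saturated corners of degree 2
(`cnt_unsat_le_outward_add`).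

These inequalities are summed over all faces. The crucial point is that each unsaturated vertex has
at most one supported corner on a non-external face (`IsPatch.cnt_supported_le`): a neighbour of
degree 3 has its matching edge on only one of the two faces along the connecting edge, a neighbour
of degree 2 has an external face, and support of a corner needs both of its neighbours. All other
sums are given by `n`, `n₂`, the number of unsaturated vertices, and the number of those of degree
2, and the claim follows by linear arithmetic. Only local properties of the rotation system enter,
not Euler's formula.
-/

/-! ### Counting over unions of orbits -/

open scoped Classical in
/-- The number of elements of the finset `A` with the property `p`. -/
noncomputable def cnt {D : Type*} (A : Finset D) (p : D → Prop) : ℕ :=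
  ∑ d ∈ A, if p d then 1 else 0

open scoped Classical in
theorem cnt_eq_card {D : Type*} (A : Finset D) (p : D → Prop) :
    cnt A p = (A.filter p).card :=
  (Finset.card_filter p A).symm

theorem cnt_true {D : Type*} (A : Finset D) : cnt A (fun _ => True) = A.card := by
  simp [cnt]

theorem sum_comp_perm {D : Type*} {φ : Equiv.Perm D} {A : Finset D}
    (hA : ∀ d, φ d ∈ A ↔ d ∈ A) (f : D → ℕ) : ∑ d ∈ A, f (φ d) = ∑ d ∈ A, f d :=
  Finset.sum_equiv φ (fun d => (hA d).symm) fun _ _ => rfl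

theorem cnt_comp_perm {D : Type*} {φ : Equiv.Perm D} {A : Finset D}
    (hA : ∀ d, φ d ∈ A ↔ d ∈ A) (p : D → Prop) : cnt A (fun d => p (φ d)) = cnt A p := by
  classical
  exact sum_comp_perm hA fun d => if p d then 1 else 0

theorem cnt_comp_perm_symm {D : Type*} {φ : Equiv.Perm D} {A : Finset D}
    (hA : ∀ d, φ d ∈ A ↔ d ∈ A) (p : D → Prop) : cnt A (fun d => p (φ.symm d)) = cnt A p := by
  rw [← cnt_comp_perm hA]
  simp

theorem cnt_and_add_cnt_not_and {D : Type*} (A : Finset D) (p q : D → Prop) :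
    cnt A (fun d => p d ∧ q d) + cnt A (fun d => ¬ p d ∧ q d) = cnt A q := by
  classical
  unfold cnt
  rw [← Finset.sum_add_distrib]
  refine Finset.sum_congr rfl fun d _ => ?_
  by_cases hp : p d <;> simp [hp]

theorem cnt_le_cnt_of_injOn {D E : Type*} {A : Finset D} {B : Finset E} {p : D → Prop}
    {q : E → Prop} (f : D → E) (hf : ∀ d ∈ A, p d → f d ∈ B ∧ q (f d))
    (hinj : ∀ d ∈ A, p d → ∀ e ∈ A, p e → f d = f e → d = e) : cnt A p ≤ cnt B q := by
  rw [cnt_eq_card, cnt_eq_card]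
  refine Finset.card_le_card_of_injOn f ?_ ?_
  · intro d hd
    simp only [Finset.coe_filter, Set.mem_ofPred_eq] at hd ⊢
    exact hf d hd.1 hd.2
  · intro d hd e he hde
    simp only [Finset.coe_filter, Set.mem_ofPred_eq] at hd he
    exact hinj d hd.1 hd.2 e he.1 he.2 hde

/-- A labelling of the elements of the cycles of `φ` by predicates `U` and `O` that behaves like
a maximal matching along the boundary walk of a face: `U d` says that the tail of the dart `d` is
unsaturated, and `O d` that `d` is an edge of the matching. -/
structure IsMatchingLabelling {D : Type*} (φ : Equiv.Perm D) (U O : D → Prop) : Prop where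
  not_unsat_next : ∀ d, U d → ¬ U (φ d)
  not_edge_of_tail : ∀ d, U d → ¬ O d
  not_edge_of_head : ∀ d, U (φ d) → ¬ O d
  not_edge_next : ∀ d, O d → ¬ O (φ d)

namespace IsMatchingLabelling

variable {D : Type*} {φ : Equiv.Perm D} {U O : D → Prop} {A : Finset D}

/-- The corner before `d` is saturated by an edge that is not an edge of the boundary walk at
this corner. -/
def Outward (φ : Equiv.Perm D) (U O : D → Prop) (d : D) : Prop :=
  ¬ U d ∧ ¬ O d ∧ ¬ O (φ.symm d)

/-- The corner before `d` is unsaturated, and the boundary walk contains the matching edges of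
both of its neighbours. -/
def Supported (φ : Equiv.Perm D) (U O : D → Prop) (d : D) : Prop :=
  U d ∧ O (φ d) ∧ O (φ.symm (φ.symm d))

/-- Every corner is unsaturated, or outward, or one of the two ends of a matching edge of the
boundary walk. -/
theorem card_eq (h : IsMatchingLabelling φ U O) (hA : ∀ d, φ d ∈ A ↔ d ∈ A) :
    A.card = cnt A U + cnt A (Outward φ U O) + 2 * cnt A O := by
  classical
  have key : cnt A U + cnt A (Outward φ U O) + cnt A O + cnt A (fun d => O (φ.symm d)) = A.card := by
    simp only [cnt, ← Finset.sum_add_distrib, Finset.card_eq_sum_ones]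
    refine Finset.sum_congr rfl fun d _ => ?_
    have h2 := h.not_edge_of_tail d
    have h3 := h.not_edge_of_head (φ.symm d)
    have h4 := h.not_edge_next (φ.symm d)
    simp only [Equiv.apply_symm_apply] at h3 h4
    unfold Outward
    split_ifs <;> first | rfl | (exfalso; tauto)
  rw [cnt_comp_perm_symm hA] at key
  omega

theorem cnt_unsat_le (h : IsMatchingLabelling φ U O) (hA : ∀ d, φ d ∈ A ↔ d ∈ A) :
    cnt A U ≤ cnt A (Outward φ U O) + cnt A O := by
  classical
  -- The corner that follows an unsaturated one is outward or starts a matching edge.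
  rw [← cnt_comp_perm hA (Outward φ U O), ← cnt_comp_perm hA O]
  simp only [cnt, ← Finset.sum_add_distrib]
  refine Finset.sum_le_sum fun d _ => ?_
  have h1 := h.not_unsat_next d
  have h2 := h.not_edge_of_tail d
  simp only [Outward, Equiv.symm_apply_apply]
  split_ifs <;> first | omega | (exfalso; tauto)

/-- An unsaturated corner that is not supported is adjacent to an outward corner. -/
theorem cnt_unsat_le_supported (h : IsMatchingLabelling φ U O) (hA : ∀ d, φ d ∈ A ↔ d ∈ A) :
    cnt A U ≤ cnt A (Supported φ U O) + 2 * cnt A (Outward φ U O) := by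
  classical
  have key : cnt A U ≤ cnt A (Supported φ U O) + cnt A (fun d => Outward φ U O (φ d))
      + cnt A (fun d => Outward φ U O (φ.symm d)) := by
    simp only [cnt, ← Finset.sum_add_distrib]
    refine Finset.sum_le_sum fun d _ => ?_
    have h1 := h.not_unsat_next d
    have h1' := h.not_unsat_next (φ.symm d)
    have h2 := h.not_edge_of_tail d
    have h3 := h.not_edge_of_head (φ.symm d)
    simp only [Equiv.apply_symm_apply] at h1' h3
    have h5 : U d → Supported φ U O d ∨ Outward φ U O (φ d) ∨ Outward φ U O (φ.symm d) := by
      simp only [Outward, Supported, Equiv.symm_apply_apply]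
      tauto
    split_ifs <;> first | omega | (exfalso; tauto)
  rw [cnt_comp_perm hA, cnt_comp_perm_symm hA] at key
  omega

theorem cnt_supported_le (hA : ∀ d, φ d ∈ A ↔ d ∈ A) :
    cnt A (Supported φ U O) ≤ cnt A U ∧ cnt A (Supported φ U O) ≤ cnt A O := by
  classical
  constructor
  · refine Finset.sum_le_sum fun d _ => ?_
    unfold Supported
    split_ifs <;> first | omega | (exfalso; tauto)
  · rw [← cnt_comp_perm hA O]
    refine Finset.sum_le_sum fun d _ => ?_
    unfold Supported
    split_ifs <;> first | omega | (exfalso; tauto)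

/-- A hexagon has at most as many unsupported unsaturated corners as it has outward corners. -/
theorem cnt_unsat_le_of_card_eq_six (h : IsMatchingLabelling φ U O)
    (hA : ∀ d, φ d ∈ A ↔ d ∈ A) (h6 : A.card = 6) :
    cnt A U ≤ cnt A (Supported φ U O) + cnt A (Outward φ U O) := by
  have h1 := h.card_eq hA
  have h2 := h.cnt_unsat_le hA
  have h3 := h.cnt_unsat_le_supported hA
  have h4 := cnt_supported_le (U := U) (O := O) hA
  omega

/-- The difference of the numbers of unsupported unsaturated corners and of outward corners of a
face of length `k` is at most `(k - 2) / 3`. -/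
theorem three_mul_cnt_unsat_le (h : IsMatchingLabelling φ U O)
    (hA : ∀ d, φ d ∈ A ↔ d ∈ A) (h0 : A.Nonempty) :
    3 * cnt A U + 2 ≤ 3 * cnt A (Supported φ U O) + 3 * cnt A (Outward φ U O) + A.card := by
  have h1 := h.card_eq hA
  have h2 := h.cnt_unsat_le hA
  have h3 := h.cnt_unsat_le_supported hA
  have h4 := cnt_supported_le (U := U) (O := O) hA
  have h5 := h0.card_pos
  omega

/-- The bound for external faces. Here `T d` says that the tail of `d` has degree 2; the
hypothesis on `T` is that no edge of the boundary walk joins two vertices of degree 3. -/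
theorem cnt_unsat_le_outward_add (h : IsMatchingLabelling φ U O) (hA : ∀ d, φ d ∈ A ↔ d ∈ A)
    {T : D → Prop} (hT : ∀ d ∈ A, T d ∨ T (φ d)) :
    cnt A U ≤ cnt A (Outward φ U O) + cnt A (fun d => ¬ U d ∧ T d) := by
  classical
  -- The corner after an unsaturated one is outward, or has degree 2, or starts a matching edge
  -- whose other end has degree 2.
  have key : cnt A U ≤ cnt A (fun d => Outward φ U O (φ d))
      + (cnt A (fun d => U d ∧ T (φ d)) + cnt A (fun d => O (φ d) ∧ T (φ (φ d)))) := by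
    simp only [cnt, ← Finset.sum_add_distrib]
    refine Finset.sum_le_sum fun d hd => ?_
    have h1 := h.not_unsat_next d
    have h2 := h.not_edge_of_tail d
    have h5 := hT (φ d) ((hA d).2 hd)
    simp only [Outward, Equiv.symm_apply_apply]
    split_ifs <;> first | omega | (exfalso; tauto)
  have h6 : cnt A (fun d => U d ∧ T (φ d)) + cnt A (fun d => O d ∧ T (φ d))
      ≤ cnt A (fun d => ¬ U d ∧ T d) := by
    rw [← cnt_comp_perm hA (fun d => ¬ U d ∧ T d)]
    simp only [cnt, ← Finset.sum_add_distrib]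
    refine Finset.sum_le_sum fun d _ => ?_
    have h1 := h.not_unsat_next d
    have h2 := h.not_edge_of_tail d
    have h3 := h.not_edge_of_head d
    split_ifs <;> first | omega | (exfalso; tauto)
  rw [cnt_comp_perm hA, cnt_comp_perm hA (fun d => O d ∧ T (φ d))] at key
  omega

end IsMatchingLabelling

/-! ### Maximal matchings -/

namespace SimpleGraph.Subgraph

variable {V : Type*} {G : SimpleGraph V} {M : G.Subgraph}

theorem not_adj_of_maximal_isMatching (hM : Maximal (fun M' : G.Subgraph => M'.IsMatching) M)
    {v w : V} (hv : v ∉ M.verts) (hw : w ∉ M.verts) : ¬ G.Adj v w := by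
  intro hvw
  have hsup : (M ⊔ G.subgraphOfAdj hvw).IsMatching := by
    refine hM.prop.sup (.subgraphOfAdj hvw) ?_
    rw [hM.prop.support_eq_verts, (IsMatching.subgraphOfAdj hvw).support_eq_verts]
    simp [hv, hw]
  exact hv ((hM.le_of_ge hsup le_sup_left).1 (by simp))

theorem IsMatching.ncard_verts [Finite V] (hM : M.IsMatching) :
    M.verts.ncard = 2 * M.edgeSet.ncard := by
  classical
  have := Fintype.ofFinite V
  have h := M.spanningCoe.sum_degrees_eq_twice_card_edges
  rw [← edgeSet_spanningCoe, ← coe_edgeFinset, Set.ncard_coe_finset, ← h,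
    Set.ncard_eq_toFinset_card', Finset.card_eq_sum_ones, ← Finset.sum_filter_add_sum_filter_not
      Finset.univ (fun v => v ∈ M.verts) (fun v => M.spanningCoe.degree v)]
  have h1 : ∀ v ∈ Finset.univ.filter (fun v => v ∈ M.verts), M.spanningCoe.degree v = 1 := by
    intro v hv
    rw [Finset.mem_filter] at hv
    rw [_root_.SimpleGraph.degree_eq_one_iff_existsUnique_adj]
    exact hM hv.2
  have h2 : ∀ v ∈ Finset.univ.filter (fun v => ¬ v ∈ M.verts), M.spanningCoe.degree v = 0 := by
    intro v hv
    rw [Finset.mem_filter] at hv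
    refine Nat.eq_zero_of_not_pos fun hpos => ?_
    obtain ⟨w, hw⟩ := (_root_.SimpleGraph.degree_pos_iff_exists_adj _ _).1 hpos
    exact hv.2 (M.edge_vert hw)
  rw [Finset.sum_congr rfl h1, Finset.sum_congr rfl h2]
  simp only [Finset.sum_const_zero, add_zero]
  congr 1
  ext v
  simp

/-- The darts of a matching correspond to the vertices that it saturates. -/
theorem IsMatching.cnt_darts [Fintype V] [DecidableRel G.Adj]
    (hM : M.IsMatching) : cnt Finset.univ (fun d : G.Dart => M.Adj d.fst d.snd) = M.verts.ncard := by
  classical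
  rw [cnt_eq_card, Set.ncard_eq_toFinset_card']
  refine Finset.card_bij (fun d _ => d.fst) ?_ ?_ ?_
  · intro d hd
    simpa using M.edge_vert (Finset.mem_filter.1 hd).2
  · intro d hd e he hde
    have hd' := (Finset.mem_filter.1 hd).2
    have he' := (Finset.mem_filter.1 he).2
    refine Dart.ext _ _ (Prod.ext hde ?_)
    rw [← hde] at he'
    exact hM.eq_of_adj_left hd' he'
  · intro v hv
    obtain ⟨w, hw, -⟩ := hM (Set.mem_toFinset.1 hv)
    exact ⟨⟨(v, w), M.adj_sub hw⟩, by simpa using hw, rfl⟩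

end SimpleGraph.Subgraph

theorem exists_maximal_matching_of_saturationNumber {V : Type*} [Finite V] (G : SimpleGraph V) :
    ∃ M : G.Subgraph, Maximal (fun M' : G.Subgraph => M'.IsMatching) M ∧
      M.edgeSet.ncard = saturationNumber G := by
  obtain ⟨M, -, hM⟩ := (Set.toFinite {M : G.Subgraph | M.IsMatching}).exists_le_maximal
    (a := ⊥) (by intro v hv; simp at hv)
  exact Nat.sInf_mem (s := {m | ∃ M : G.Subgraph,
    Maximal (fun M' : G.Subgraph => M'.IsMatching) M ∧ M.edgeSet.ncard = m}) ⟨_, M, hM, rfl⟩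

/-- A sum over darts of a function of their tails. -/
theorem sum_dart_fst {V : Type*} [Fintype V] [DecidableEq V] (G : SimpleGraph V)
    [DecidableRel G.Adj] (f : V → ℕ) : ∑ d : G.Dart, f d.fst = ∑ v, G.degree v * f v := by
  rw [← Finset.sum_fiberwise Finset.univ (fun d : G.Dart => d.fst)]
  refine Finset.sum_congr rfl fun v _ => ?_
  rw [← G.dart_fst_fiber_card_eq_degree v, ← smul_eq_mul, ← Finset.sum_const]
  exact Finset.sum_congr rfl fun d hd => by rw [(Finset.mem_filter.1 hd).2]

/-! ### Rotation systems of small degree -/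

namespace RotationSystem

variable {V : Type*} {G : SimpleGraph V} (R : RotationSystem G)

theorem facePerm_apply (d : G.Dart) : R.facePerm d = R.next d.symm := rfl

theorem facePerm_symm_apply (d : G.Dart) : R.facePerm.symm d = (R.next.symm d).symm := rfl

theorem facePerm_fst (d : G.Dart) : (R.facePerm d).fst = d.snd := R.next_fst d.symm

theorem next_symm_fst (d : G.Dart) : (R.next.symm d).fst = d.fst := by
  rw [← R.next_fst, Equiv.apply_symm_apply]

theorem faceOf_facePerm (d : G.Dart) : R.faceOf (R.facePerm d) = R.faceOf d :=
  Quotient.sound (Equiv.Perm.sameCycle_apply_left.2 (.refl _ _))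

theorem faceOf_facePerm_symm (d : G.Dart) : R.faceOf (R.facePerm.symm d) = R.faceOf d := by
  rw [← faceOf_facePerm, Equiv.apply_symm_apply]

theorem eq_of_next_eq_self {d e : G.Dart} (h : R.next d = d) (hde : d.fst = e.fst) : e = d := by
  obtain ⟨i, hi⟩ := R.next_cyclic d e hde
  rw [Equiv.Perm.zpow_apply_eq_self_of_apply_eq_self h] at hi
  exact hi.symm

variable [Fintype V] [DecidableEq V] [DecidableRel G.Adj]

theorem next_ne_self {d : G.Dart} (hd : 2 ≤ G.degree d.fst) : R.next d ≠ d := by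
  intro h
  have h1 : (Finset.univ.filter fun e : G.Dart => e.fst = d.fst) ⊆ {d} := fun e he =>
    Finset.mem_singleton.2 (R.eq_of_next_eq_self h (Finset.mem_filter.1 he).2.symm)
  have h2 := Finset.card_le_card h1
  rw [G.dart_fst_fiber_card_eq_degree, Finset.card_singleton] at h2
  omega

/-- In a rotation of at most three darts, any two of them are consecutive. -/
theorem eq_next_or_eq_next {d e : G.Dart} (h3 : G.degree d.fst ≤ 3) (hfst : d.fst = e.fst)
    (hne : d ≠ e) : e = R.next d ∨ d = R.next e := by
  by_contra! hcon
  have hd : R.next d ≠ d := fun h => hne (R.eq_of_next_eq_self h hfst).symm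
  have he : R.next e ≠ e := fun h => hne (R.eq_of_next_eq_self h hfst.symm)
  have hde : R.next d ≠ R.next e := fun h => hne (R.next.injective h)
  have h1 : ({d, e, R.next d, R.next e} : Finset G.Dart) ⊆
      Finset.univ.filter fun e : G.Dart => e.fst = d.fst := by
    intro x hx
    simp only [Finset.mem_insert, Finset.mem_singleton] at hx
    rcases hx with rfl | rfl | rfl | rfl <;> simp [R.next_fst, hfst]
  have h2 := Finset.card_le_card h1
  rw [G.dart_fst_fiber_card_eq_degree, Finset.card_eq_of_equiv_fin (n := 4)] at h2
  · omega
  · refine Finset.equivFinOfCardEq ?_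
    rw [Finset.card_insert_of_notMem, Finset.card_insert_of_notMem, Finset.card_insert_of_notMem,
      Finset.card_singleton]
    · simpa using hde
    · simpa using ⟨hcon.1, he.symm⟩
    · simpa using ⟨hne, hd.symm, hcon.2⟩

/-- If the rotation returns to `d` after two steps, then there are no darts at the tail of `d`
other than these two. -/
theorem eq_or_eq_next_of_next_next {d e : G.Dart} (h3 : G.degree d.fst ≤ 3)
    (hd : R.next (R.next d) = d) (hfst : d.fst = e.fst) : e = d ∨ e = R.next d := by
  by_cases hne : d = e
  · exact .inl hne.symm
  · rcases R.eq_next_or_eq_next h3 hfst hne with h | h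
    · exact .inr h
    · exact .inr (R.next.injective (by rw [hd, ← h]))

/-- A maximal matching labels the boundary walks of the faces. Minimum degree 2 excludes that a
boundary walk turns back and runs along the same matching edge twice in a row. -/
theorem isMatchingLabelling {M : G.Subgraph}
    (hM : Maximal (fun M' : G.Subgraph => M'.IsMatching) M) (h2 : ∀ v, 2 ≤ G.degree v) :
    IsMatchingLabelling R.facePerm (fun d => d.fst ∉ M.verts) (fun d => M.Adj d.fst d.snd) where
  not_unsat_next d hd hd' := by
    rw [facePerm_fst] at hd'
    exact SimpleGraph.Subgraph.not_adj_of_maximal_isMatching hM hd hd' d.adj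
  not_edge_of_tail d hd h := hd (M.edge_vert h)
  not_edge_of_head d hd h := by
    rw [facePerm_fst] at hd
    exact hd (M.edge_vert h.symm)
  not_edge_next d h h' := by
    rw [facePerm_fst] at h'
    refine R.next_ne_self (h2 d.symm.fst) (SimpleGraph.Dart.ext _ _ (Prod.ext (R.next_fst _) ?_))
    exact hM.prop.eq_of_adj_left h' h.symm

end RotationSystem

/-! ### Faces of a patch -/

namespace RotationSystem

open IsMatchingLabelling

variable {V : Type*} [Fintype V] {G : SimpleGraph V} [DecidableRel G.Adj]
  {R : RotationSystem G} {ext : Set R.Face} {M : G.Subgraph}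

open scoped Classical in
/-- The darts that trace the face `F`. -/
noncomputable def faceDarts (R : RotationSystem G) (F : R.Face) : Finset G.Dart :=
  Finset.univ.filter fun d => R.faceOf d = F

theorem mem_faceDarts {F : R.Face} {d : G.Dart} : d ∈ R.faceDarts F ↔ R.faceOf d = F := by
  simp [faceDarts]

theorem facePerm_mem_faceDarts {F : R.Face} (d : G.Dart) :
    R.facePerm d ∈ R.faceDarts F ↔ d ∈ R.faceDarts F := by
  rw [mem_faceDarts, mem_faceDarts, faceOf_facePerm]

theorem card_faceDarts (F : R.Face) : (R.faceDarts F).card = R.faceLength F := by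
  rw [faceLength, ← Set.ncard_coe_finset]
  congr 1
  ext d
  simp [mem_faceDarts]

theorem faceDarts_nonempty (F : R.Face) : (R.faceDarts F).Nonempty := by
  obtain ⟨d, rfl⟩ := Quotient.exists_rep F
  exact ⟨d, mem_faceDarts.2 rfl⟩

instance : Finite R.Face := inferInstanceAs (Finite (Quotient _))

theorem cnt_eq_sum_faceDarts [Fintype R.Face] [DecidablePred (· ∈ ext)] (p : G.Dart → Prop) :
    cnt (Finset.univ.filter fun d => R.faceOf d ∉ ext) p =
      ∑ F with F ∉ ext, cnt (R.faceDarts F) p := by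
  classical
  unfold cnt
  rw [← Finset.sum_fiberwise_of_maps_to (g := R.faceOf)
    (t := Finset.univ.filter fun F => F ∉ ext) (by simp)]
  refine Finset.sum_congr rfl fun F hF => Finset.sum_congr ?_ fun _ _ => rfl
  ext d
  have hF' := (Finset.mem_filter.1 hF).2
  simp only [Finset.mem_filter, Finset.mem_univ, true_and, mem_faceDarts]
  constructor
  · exact And.right
  · rintro rfl
    exact ⟨hF', rfl⟩

variable [DecidableEq V]

/-- At a vertex of degree at most 3, supported corners of two consecutive non-external faces cannot
exist: their common neighbour would be matched within both faces, hence have degree 2, but lie on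
no external face. -/
theorem IsPatch.not_supported_next (hpatch : R.IsPatch ext) (hM : M.IsMatching) {d : G.Dart}
    (hd : R.faceOf d ∉ ext) (hd' : R.faceOf (R.next d) ∉ ext)
    (hs : Supported R.facePerm (fun d => d.fst ∉ M.verts) (fun d => M.Adj d.fst d.snd) d)
    (hs' : Supported R.facePerm (fun d => d.fst ∉ M.verts) (fun d => M.Adj d.fst d.snd)
      (R.next d)) : False := by
  have h1 := hs.2.1
  have h2 := hs'.2.2
  -- `d.symm` starts at the common neighbour, and its predecessor and successor in the rotation
  -- there are both matching edges, hence equal.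
  have hx : R.facePerm.symm (R.next d) = d.symm := by
    rw [facePerm_symm_apply, Equiv.symm_apply_apply]
  rw [hx, facePerm_symm_apply] at h2
  rw [facePerm_apply] at h1
  have hfst : (R.next d.symm).fst = (R.next.symm d.symm).fst := by
    rw [R.next_fst, R.next_symm_fst]
  have hnext : R.next d.symm = R.next.symm d.symm := by
    refine SimpleGraph.Dart.ext _ _ (Prod.ext hfst ?_)
    have h2' : M.Adj (R.next.symm d.symm).fst (R.next.symm d.symm).snd := h2.symm
    rw [← hfst] at h2'
    exact hM.eq_of_adj_left h1 h2'
  have hnn : R.next (R.next d.symm) = d.symm := by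
    rw [hnext, Equiv.apply_symm_apply]
  have hdeg : ∀ v, G.degree v ≤ 3 := fun v => by rcases hpatch.degree_eq v with h | h <;> omega
  have hall : ∀ e : G.Dart, d.symm.fst = e.fst → e = d.symm ∨ e = R.next d.symm := fun e he =>
    R.eq_or_eq_next_of_next_next (hdeg _) hnn he
  have h3 : G.degree d.symm.fst = 3 := by
    refine hpatch.degree_internal _ ?_
    rintro F hF ⟨e, he, rfl⟩
    rcases hall e he.symm with rfl | rfl
    · rw [← hx, R.faceOf_facePerm_symm] at hF
      exact hd' hF
    · rw [← R.facePerm_apply, R.faceOf_facePerm] at hF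
      exact hd hF
  have hsub : (Finset.univ.filter fun e : G.Dart => e.fst = d.symm.fst) ⊆
      {d.symm, R.next d.symm} := fun e he => by
    simpa using hall e (Finset.mem_filter.1 he).2.symm
  have hcard := (Finset.card_le_card hsub).trans Finset.card_le_two
  rw [G.dart_fst_fiber_card_eq_degree] at hcard
  omega

/-- Every unsaturated vertex has at most one supported corner in a non-external face. -/
theorem IsPatch.cnt_supported_le (hpatch : R.IsPatch ext) (hM : M.IsMatching) (A : Finset G.Dart)
    (hA : ∀ d ∈ A, R.faceOf d ∉ ext) :
    cnt A (Supported R.facePerm (fun d => d.fst ∉ M.verts) (fun d => M.Adj d.fst d.snd))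
      ≤ cnt Finset.univ (fun v : V => v ∉ M.verts) := by
  refine cnt_le_cnt_of_injOn (fun d => d.fst) (fun d _ hd => ⟨Finset.mem_univ _, hd.1⟩) ?_
  intro d hdA hds e heA hes hde
  by_contra hne
  have hdeg : G.degree d.fst ≤ 3 := by rcases hpatch.degree_eq d.fst with h | h <;> omega
  rcases R.eq_next_or_eq_next hdeg hde hne with rfl | rfl
  · exact hpatch.not_supported_next hM (hA _ hdA) (hA _ heA) hds hes
  · exact hpatch.not_supported_next hM (hA _ heA) (hA _ hdA) hes hds

/-- The weight in the bound of an internal face of length `k`. It vanishes for hexagons. -/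
noncomputable def defectWeight (k : ℕ) : ℝ :=
  if Odd k then (k : ℝ) - 2 else if k ≠ 6 then (k : ℝ) else 0

theorem sum_defectWeight_numInternal [Fintype R.Face] [DecidablePred R.IsInternal] :
    (∑ k ∈ Finset.range (Fintype.card G.Dart + 1) with Odd k,
          ((k : ℝ) - 2) * (R.numInternal k : ℝ))
      + ∑ k ∈ Finset.range (Fintype.card G.Dart + 1) with (Even k ∧ k ≠ 6),
          (k : ℝ) * (R.numInternal k : ℝ)
      = ∑ F with R.IsInternal F, defectWeight (R.faceLength F) := by
  classical
  have hmaps : ∀ F ∈ Finset.univ.filter R.IsInternal,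
      R.faceLength F ∈ Finset.range (Fintype.card G.Dart + 1) := fun F _ => by
    rw [Finset.mem_range, ← card_faceDarts, Nat.lt_succ_iff]
    exact Finset.card_le_univ _
  rw [← Finset.sum_fiberwise_of_maps_to' hmaps, Finset.sum_filter, Finset.sum_filter,
    ← Finset.sum_add_distrib]
  refine Finset.sum_congr rfl fun k _ => ?_
  have hnum : R.numInternal k =
      ((Finset.univ.filter R.IsInternal).filter fun F => R.faceLength F = k).card := by
    rw [numInternal, ← Set.ncard_coe_finset]
    congr 1
    ext F
    simp [and_comm]
  rw [Finset.sum_const, ← hnum, nsmul_eq_mul, defectWeight]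
  by_cases hk : Odd k
  · have : ¬ Even k := Nat.not_even_iff_odd.2 hk
    simp [hk, this, mul_comm]
  · have : Even k := Nat.not_odd_iff_even.1 hk
    by_cases h6 : k = 6 <;> simp [hk, this, h6, mul_comm]

theorem IsPatch.three_mul_cnt_faceDarts_le (hpatch : R.IsPatch ext)
    [DecidablePred R.IsInternal] {U O : G.Dart → Prop}
    (h : IsMatchingLabelling R.facePerm U O) {F : R.Face} (hF : F ∉ ext) :
    3 * (cnt (R.faceDarts F) U : ℝ) ≤ 3 * cnt (R.faceDarts F) (Supported R.facePerm U O)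
      + 3 * cnt (R.faceDarts F) (Outward R.facePerm U O)
      + if R.IsInternal F then defectWeight (R.faceLength F) else 0 := by
  have hinv := facePerm_mem_faceDarts (R := R) (F := F)
  by_cases h6 : R.faceLength F = 6
  · have hw : defectWeight 6 = 0 := by
      rw [defectWeight, if_neg (by decide), if_neg (by simp)]
    have h1 := h.cnt_unsat_le_of_card_eq_six hinv ((card_faceDarts F).trans h6)
    have h2 : (cnt (R.faceDarts F) U : ℝ) ≤ cnt (R.faceDarts F) (Supported R.facePerm U O)
        + cnt (R.faceDarts F) (Outward R.facePerm U O) := by exact_mod_cast h1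
    rw [h6, hw, ite_self]
    linarith
  · rw [if_pos ((hpatch.hexagon_or_internal F hF).resolve_left h6)]
    have h1 := h.three_mul_cnt_unsat_le hinv (faceDarts_nonempty F)
    rw [card_faceDarts] at h1
    have h2 : 3 * (cnt (R.faceDarts F) U : ℝ) + 2 ≤
        3 * cnt (R.faceDarts F) (Supported R.facePerm U O)
        + 3 * cnt (R.faceDarts F) (Outward R.facePerm U O) + R.faceLength F := by
      exact_mod_cast h1
    have h3 : (R.faceLength F : ℝ) - 2 ≤ defectWeight (R.faceLength F) := by
      unfold defectWeight
      -- For even lengths the weight is larger than needed.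
      split_ifs
      · exact le_rfl
      · linarith
    linarith

/-- The bounds for the single faces, summed over all non-external faces. -/
theorem IsPatch.three_mul_cnt_le (hpatch : R.IsPatch ext) [DecidablePred (· ∈ ext)]
    {U O : G.Dart → Prop} (h : IsMatchingLabelling R.facePerm U O) {A : Finset G.Dart}
    (hA : A = Finset.univ.filter fun d => R.faceOf d ∉ ext) :
    3 * (cnt A U : ℝ) ≤ 3 * cnt A (Supported R.facePerm U O) + 3 * cnt A (Outward R.facePerm U O)
      + ((∑ k ∈ Finset.range (Fintype.card G.Dart + 1) with Odd k,
            ((k : ℝ) - 2) * (R.numInternal k : ℝ))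
          + ∑ k ∈ Finset.range (Fintype.card G.Dart + 1) with (Even k ∧ k ≠ 6),
            (k : ℝ) * (R.numInternal k : ℝ)) := by
  classical
  have := Fintype.ofFinite R.Face
  -- External faces are not internal, because they have a vertex of degree 2.
  have hext : ∑ F with R.IsInternal F, defectWeight (R.faceLength F) =
      ∑ F with F ∉ ext, if R.IsInternal F then defectWeight (R.faceLength F) else 0 := by
    rw [← Finset.sum_filter, Finset.filter_filter]
    refine Finset.sum_congr (Finset.filter_congr fun F _ => ?_) fun _ _ => rfl
    refine ⟨fun hF => ⟨fun hFe => ?_, hF⟩, And.right⟩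
    obtain ⟨v, hv, hv2⟩ := hpatch.external F hFe
    have := hF v hv
    omega
  rw [sum_defectWeight_numInternal, hext, hA, cnt_eq_sum_faceDarts, cnt_eq_sum_faceDarts,
    cnt_eq_sum_faceDarts]
  push_cast
  rw [Finset.mul_sum, Finset.mul_sum, Finset.mul_sum, ← Finset.sum_add_distrib,
    ← Finset.sum_add_distrib]
  exact Finset.sum_le_sum fun F hF =>
    hpatch.three_mul_cnt_faceDarts_le h (Finset.mem_filter.1 hF).2

end RotationSystem

/-! ### The lower bound -/

/-- In a graph with all degrees 2 or 3, the darts that start in a given set of vertices are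
three for each of its vertices, less one for each of those of degree 2. -/
theorem cnt_dart_fst {V : Type*} [Fintype V] [DecidableEq V] {G : SimpleGraph V}
    [DecidableRel G.Adj] (hdeg : ∀ v, G.degree v = 2 ∨ G.degree v = 3) (p : V → Prop) :
    cnt Finset.univ (fun d : G.Dart => p d.fst) + cnt Finset.univ (fun v => p v ∧ G.degree v = 2)
      = 3 * cnt Finset.univ p := by
  classical
  unfold cnt
  rw [sum_dart_fst G fun v => if p v then 1 else 0, ← Finset.sum_add_distrib, Finset.mul_sum]
  refine Finset.sum_congr rfl fun v _ => ?_
  rcases hdeg v with h | h <;> by_cases hp : p v <;> simp [h, hp]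

/- No face is longer than the number of darts, so the sums run over all odd `k`, and over all
even `k` other than 6, for which there are internal `k`-gonal defects. -/
theorem theorem1 {V : Type*} [Fintype V] [DecidableEq V] (G : SimpleGraph V) [DecidableRel G.Adj]
    (R : RotationSystem G) (ext : Set R.Face)
    (hpatch : R.IsPatch ext) (hconvex : R.IsPseudoconvex ext) :
    (saturationNumber G : ℝ) ≥ (Fintype.card V : ℝ) / 3
      - (1 / 18 : ℝ) *
        ((∑ k ∈ Finset.range (Fintype.card G.Dart + 1) with Odd k,
            ((k : ℝ) - 2) * (R.numInternal k : ℝ))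
          + ∑ k ∈ Finset.range (Fintype.card G.Dart + 1) with (Even k ∧ k ≠ 6),
            (k : ℝ) * (R.numInternal k : ℝ))
      - (numDegreeTwo G : ℝ) / 6 := by
  classical
  obtain ⟨M, hM, hsat⟩ := exists_maximal_matching_of_saturationNumber G
  have hdeg := hpatch.degree_eq
  have h := R.isMatchingLabelling hM fun v => by rcases hdeg v with h | h <;> omega
  obtain ⟨A, hA⟩ : ∃ A, A = Finset.univ.filter fun d => R.faceOf d ∉ ext := ⟨_, rfl⟩
  obtain ⟨B, hB⟩ : ∃ B, B = Finset.univ.filter fun d => ¬ R.faceOf d ∉ ext := ⟨_, rfl⟩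
  have hAB : ∀ p, cnt Finset.univ p = cnt A p + cnt B p := fun p => by
    rw [hA, hB]
    exact (Finset.sum_filter_add_sum_filter_not _ _ _).symm
  have hnonext := hpatch.three_mul_cnt_le h hA
  have hsupp := hpatch.cnt_supported_le hM.prop A (by simp [hA])
  have hext := h.cnt_unsat_le_outward_add (A := B) (T := fun d => G.degree d.fst = 2)
    (fun d => by simp [hB, R.faceOf_facePerm]) (fun d hd => by
      have h1 := hconvex d (by simpa [hB] using hd)
      rw [R.facePerm_fst]
      rcases hdeg d.fst with h2 | h2
      · exact .inl h2
      · exact .inr ((hdeg d.snd).resolve_right fun h3 => h1 ⟨h2, h3⟩))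
  have htotal := h.card_eq (A := Finset.univ) (by simp)
  have hmatched := hM.prop.cnt_darts
  rw [hM.prop.ncard_verts, hsat] at hmatched
  -- Vertices and darts are counted by degree and by saturation.
  have hdarts := cnt_dart_fst hdeg fun _ => True
  have hunsat := cnt_dart_fst hdeg fun v => v ∉ M.verts
  have hsatTwo := cnt_dart_fst hdeg fun v => ¬ v ∉ M.verts ∧ G.degree v = 2
  have htwo := cnt_and_add_cnt_not_and Finset.univ (fun v => v ∉ M.verts) (fun v => G.degree v = 2)
  have hverts := cnt_and_add_cnt_not_and Finset.univ (fun v => v ∉ M.verts) (fun _ => True)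
  have hverts' : cnt Finset.univ (fun v => v ∈ M.verts) = 2 * saturationNumber G := by
    rw [← hsat, ← hM.prop.ncard_verts, cnt_eq_card, Set.ncard_eq_toFinset_card']
    congr 1
    ext v
    simp
  have hnum : cnt Finset.univ (fun v => G.degree v = 2) = numDegreeTwo G := by
    rw [cnt_eq_card, numDegreeTwo]
    congr 1
    ext v
    simp
  simp only [and_assoc, and_self, and_true, true_and, not_not, cnt_true, hnum, Finset.card_univ]
    at hdarts hunsat hsatTwo htwo hverts htotal hext
  have hU := hAB fun d => d.fst ∉ M.verts
  have hW := hAB (IsMatchingLabelling.Outward R.facePerm (fun d => d.fst ∉ M.verts)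
    (fun d => M.Adj d.fst d.snd))
  have hX := hAB fun d => d.fst ∈ M.verts ∧ G.degree d.fst = 2
  -- The counts are linearly related; the sum of `hnonext` and three times `hext` gives the claim.
  have key : 6 * Fintype.card V + 3 * cnt A (IsMatchingLabelling.Supported R.facePerm
        (fun d => d.fst ∉ M.verts) (fun d => M.Adj d.fst d.snd))
      + 3 * cnt A (IsMatchingLabelling.Outward R.facePerm
        (fun d => d.fst ∉ M.verts) (fun d => M.Adj d.fst d.snd))
      ≤ 18 * saturationNumber G + 3 * numDegreeTwo G
        + 3 * cnt A (fun d => d.fst ∉ M.verts) := by omega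
  have key' := (Nat.cast_le (α := ℝ)).2 key
  push_cast at key'
  linarith
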